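/- An \emph{empire graph} is a finite connected simple graph $G$ together with a set $A$ of \emph{empires} and a surjective map $h : V(G) \to A$, so that the vertices of $G$ are partitioned into the nonempty empires $h^{-1}(\alpha)$, $\alpha \in A$. It is an \emph{$m$-pire graph} if every empire contains at most $m$ vertices. A \emph{$J(n,m)$ graph} (a complete $m$-pire graph on $n$ empires) is an $m$-pire graph with $|A| = n$ such that for any two distinct empires $\alpha, \beta \in A$ there are adjacent vertices $v, w$ of $G$ with $h(v) = \alpha$ and $h(w) = \beta$. Then for every even integer $m \ge 2$ there exists a $J(6m, m)$ graph which is planar, i.e. which can be drawn in the plane without crossings. -/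

import Mathlib

/-- An empire graph: a finite connected simple graph on the vertex set `V`, whose vertices are
partitioned into nonempty empires. The empires are the elements of `A`, and the vertices of the
empire `α` are the `v` with `empire v = α`. -/
structure EmpireGraph (V A : Type*) where
  graph : SimpleGraph V
  empire : V → A
  finite : Finite V
  connected : graph.Connected
  empire_surjective : Function.Surjective empire

/-- An `m`-pire graph: each empire consists of at most `m` vertices. -/
def EmpireGraph.IsPire {V A : Type*} (G : EmpireGraph V A) (m : ℕ) : Prop :=
  ∀ α : A, {v : V | G.empire v = α}.ncard ≤ m

/-- A complete `m`-pire graph on `n` empires, that is, a `J(n, m)` graph: an `m`-pire graph with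
exactly `n` empires, any two distinct of which are neighbouring. -/
structure EmpireGraph.IsJ {V A : Type*} (G : EmpireGraph V A) (n m : ℕ) : Prop where
  isPire : G.IsPire m
  card_empires : Nat.card A = n
  neighbouring : ∀ α β : A, α ≠ β →
    ∃ v w : V, G.graph.Adj v w ∧ G.empire v = α ∧ G.empire w = β

/-- A drawing of a simple graph in the Euclidean plane without crossings: vertices are distinct
points, every edge is a simple arc joining its two ends, an edge passes through no vertex other
than its ends, and two distinct edges meet at most in common ends. Only the values of `arc` at
edges of the graph matter. -/
structure PlaneDrawing {V : Type*} (G : SimpleGraph V) where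
  point : V → EuclideanSpace ℝ (Fin 2)
  arc : Sym2 V → Set (EuclideanSpace ℝ (Fin 2))
  point_injective : Function.Injective point
  isArc : ∀ v w : V, G.Adj v w →
    ∃ γ : Path (point v) (point w), Function.Injective γ ∧ Set.range γ = arc s(v, w)
  mem_of_point_mem_arc : ∀ e ∈ G.edgeSet, ∀ v : V, point v ∈ arc e → v ∈ e
  arc_inter_arc : ∀ e ∈ G.edgeSet, ∀ f ∈ G.edgeSet, e ≠ f →
    arc e ∩ arc f ⊆ point '' {v : V | v ∈ e ∧ v ∈ f}

/-- A simple graph is planar if it can be drawn in the plane without crossings. -/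
def SimpleGraph.IsPlanarGraph {V : Type*} (G : SimpleGraph V) : Prop :=
  Nonempty (PlaneDrawing G)

/-! Write `m = 2k`. The `12k` empires are the triples `((c, ε), x)` with `c : Fin 3`, `ε : Bool` and
`x : ZMod (2k)`; call the `4k` empires with the same `c` a couple. The icosahedron has a perfect
matching of six edges, two for each `c`, such that the vertices opposite to a matching edge of class
`c`, in its two faces, are ends of the two matching edges of class `c + 1`. Replacing each matching
edge by a path on `4k` vertices, all joined to these two opposite vertices, keeps the graph planar.
The graph used is `k` such components, linked in a row for connectedness.

In component `r` each of the two paths of class `c` visits every empire of the couple `c` exactly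
once, so an empire has at most two vertices per component, `2k` in all. The path `(c, b)` is joined
to the end `b` of both paths of class `c + 1`. These ends carry the empires `((c + 1, b), r)` and
`((c + 1, b), r + k)`, which exhaust the couple `c + 1` as `b` and `r < k` vary. This settles
distinct couples (`exists_pathEmpire_eq`, `pathEmpire_endIndex`).

Inside a couple, the `2k` paths form a decomposition of the complete graph on `4k` empires into
Hamiltonian paths, of zigzag type (`exists_pathEmpire_eq_succ`). Planarity is shown with straight
segments: disjointness reduces to finitely many sign checks on integer coordinates
(`exists_separating_line`). -/

open Set

/-! ### Straight-line drawings. -/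

/-- The vertices of `G` are placed at `p` so that joining adjacent vertices by straight segments
gives a drawing of `G` without crossings. -/
structure IsStraightDrawing {V : Type*} (G : SimpleGraph V)
    (p : V → EuclideanSpace ℝ (Fin 2)) : Prop where
  injective : Function.Injective p
  notMem_openSegment : ∀ u v w, G.Adj u v → p w ∉ openSegment ℝ (p u) (p v)
  disjoint_openSegment : ∀ u v u' v', G.Adj u v → G.Adj u' v' → s(u, v) ≠ s(u', v') →
    Disjoint (openSegment ℝ (p u) (p v)) (openSegment ℝ (p u') (p v'))

theorem exists_injective_path_range_eq_segment {E : Type*} [NormedAddCommGroup E]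
    [NormedSpace ℝ E] {x y : E} (hxy : x ≠ y) :
    ∃ γ : Path x y, Function.Injective γ ∧ range γ = segment ℝ x y := by
  refine ⟨⟨⟨fun t => AffineMap.lineMap x y (t : ℝ), ?_⟩, ?_, ?_⟩, ?_, ?_⟩
  · exact AffineMap.lineMap_continuous.comp continuous_subtype_val
  · simp
  · simp
  · intro s t hst
    exact Subtype.ext (AffineMap.lineMap_injective ℝ hxy hst)
  · rw [segment_eq_image_lineMap]
    ext z
    constructor
    · rintro ⟨t, rfl⟩
      exact ⟨t, t.2, rfl⟩
    · rintro ⟨t, ht, rfl⟩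
      exact ⟨⟨t, ht⟩, rfl⟩

theorem mem_segment_iff_mem_openSegment_or {E : Type*} [AddCommGroup E] [Module ℝ E] {x y z : E} :
    z ∈ segment ℝ x y ↔ z = x ∨ z = y ∨ z ∈ openSegment ℝ x y := by
  rw [← insert_endpoints_openSegment]
  simp

theorem IsStraightDrawing.isPlanarGraph {V : Type*} {G : SimpleGraph V}
    {p : V → EuclideanSpace ℝ (Fin 2)} (h : IsStraightDrawing G p) : G.IsPlanarGraph := by
  have key : ∀ u v w, G.Adj u v → p w ∈ segment ℝ (p u) (p v) → w ∈ s(u, v) := by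
    intro u v w huv hw
    rw [Sym2.mem_iff]
    rcases mem_segment_iff_mem_openSegment_or.1 hw with hw | hw | hw
    · exact Or.inl (h.injective hw)
    · exact Or.inr (h.injective hw)
    · exact absurd hw (h.notMem_openSegment u v w huv)
  refine ⟨⟨p, Sym2.lift ⟨fun u v => segment ℝ (p u) (p v), fun u v => segment_symm ℝ _ _⟩,
    h.injective, ?_, ?_, ?_⟩⟩
  · intro v w hvw
    exact exists_injective_path_range_eq_segment fun e => hvw.ne (h.injective e)
  · intro e
    induction e using Sym2.ind with
    | _ u v => exact fun huv w hw => key u v w huv hw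
  · intro e
    induction e using Sym2.ind with
    | _ u v =>
      intro huv f
      induction f using Sym2.ind with
      | _ u' v' =>
        rintro huv' hne z ⟨hz, hz'⟩
        simp only [Sym2.lift_mk] at hz hz'
        have aux : ∀ w, z = p w → z ∈ p '' {w | w ∈ s(u, v) ∧ w ∈ s(u', v')} := by
          rintro w rfl
          exact ⟨w, ⟨key u v w huv hz, key u' v' w huv' hz'⟩, rfl⟩
        rcases mem_segment_iff_mem_openSegment_or.1 hz with h1 | h1 | h1
        · exact aux _ h1
        · exact aux _ h1
        rcases mem_segment_iff_mem_openSegment_or.1 hz' with h2 | h2 | h2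
        · exact aux _ h2
        · exact aux _ h2
        exact absurd h2 (disjoint_left.1 (h.disjoint_openSegment u v u' v' huv huv' hne) h1)

/-! ### Chains of translated copies. -/

/-- `k` copies of `G`, in which the vertex `a` of each copy is joined to the vertex `b` of the
next. -/
def chainGraph {C : Type*} (G : SimpleGraph C) (a b : C) (k : ℕ) : SimpleGraph (Fin k × C) where
  Adj v w := (v.1 = w.1 ∧ G.Adj v.2 w.2) ∨
    ((v.1 : ℕ) + 1 = w.1 ∧ v.2 = a ∧ w.2 = b) ∨ ((w.1 : ℕ) + 1 = v.1 ∧ w.2 = a ∧ v.2 = b)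
  symm := ⟨by
    rintro v w (⟨h, h'⟩ | h | h)
    · exact Or.inl ⟨h.symm, h'.symm⟩
    · exact Or.inr (Or.inr h)
    · exact Or.inr (Or.inl h)⟩
  loopless := ⟨by
    rintro v (⟨-, h⟩ | h | h)
    · exact h.ne rfl
    · omega
    · omega⟩

theorem chainGraph_connected {C : Type*} {G : SimpleGraph C} (hG : G.Connected) (a b : C) {k : ℕ}
    (hk : 0 < k) : (chainGraph G a b k).Connected := by
  have copy : ∀ (r : Fin k) (v w : C), (chainGraph G a b k).Reachable (r, v) (r, w) := fun r v w =>
    (hG.preconnected v w).map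
      (⟨fun v => (r, v), fun h => Or.inl ⟨rfl, h⟩⟩ : G →g chainGraph G a b k)
  have first : ∀ (n : ℕ) (hn : n < k) (v : C),
      (chainGraph G a b k).Reachable (⟨0, hk⟩, a) (⟨n, hn⟩, v) := by
    intro n
    induction n with
    | zero => exact fun hn v => copy _ _ _
    | succ n ih =>
      intro hn v
      have h : (chainGraph G a b k).Adj (⟨n, by omega⟩, a) (⟨n + 1, hn⟩, b) :=
        Or.inr (Or.inl ⟨rfl, rfl, rfl⟩)
      exact ((ih (by omega) a).trans h.reachable).trans (copy _ _ _)
  have : Nonempty (Fin k × C) := ⟨(⟨0, hk⟩, a)⟩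
  exact ⟨fun v w => (first v.1 v.1.2 v.2).symm.trans (first w.1 w.1.2 w.2)⟩

theorem map_openSegment_mem_Ioo {E : Type*} [AddCommGroup E] [Module ℝ E] (φ : E →ₗ[ℝ] ℝ)
    {x y z : E} {l u : ℝ} (hx : φ x = l) (hy : φ y = u) (hlu : l < u)
    (hz : z ∈ openSegment ℝ x y) : l < φ z ∧ φ z < u := by
  obtain ⟨α, β, hα, hβ, hαβ, rfl⟩ := hz
  rw [map_add, map_smul, map_smul, hx, hy, smul_eq_mul, smul_eq_mul]
  obtain rfl : α = 1 - β := by linarith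
  constructor <;> nlinarith

theorem map_openSegment_mem_Icc {E : Type*} [AddCommGroup E] [Module ℝ E] (φ : E →ₗ[ℝ] ℝ)
    {x y z : E} {l u : ℝ} (hx : l ≤ φ x ∧ φ x ≤ u) (hy : l ≤ φ y ∧ φ y ≤ u)
    (hz : z ∈ openSegment ℝ x y) : l ≤ φ z ∧ φ z ≤ u := by
  obtain ⟨α, β, hα, hβ, hαβ, rfl⟩ := hz
  rw [map_add, map_smul, map_smul, smul_eq_mul, smul_eq_mul]
  obtain rfl : α = 1 - β := by linarith
  constructor <;> nlinarith

/-- The values of `φ` separate everything: copy `r` lies in the closed band from `r * D + l` to `r *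
D + u`, and an open link lies strictly between two consecutive bands. Only pairs of edges in one
copy need the drawing of `G`. -/
theorem IsStraightDrawing.chainGraph {C : Type*} {G : SimpleGraph C}
    {p : C → EuclideanSpace ℝ (Fin 2)} (h : IsStraightDrawing G p) {a b : C}
    (φ : EuclideanSpace ℝ (Fin 2) →ₗ[ℝ] ℝ) (d : EuclideanSpace ℝ (Fin 2))
    (hφ : ∀ v, φ (p b) ≤ φ (p v) ∧ φ (p v) ≤ φ (p a)) (hd : φ (p a) < φ (p b) + φ d) (k : ℕ) :
    IsStraightDrawing (chainGraph G a b k) fun v => (v.1 : ℝ) • d + p v.2 := by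
  set q : Fin k × C → EuclideanSpace ℝ (Fin 2) := fun v => (v.1 : ℝ) • d + p v.2 with hq
  set l := φ (p b) with hl
  set u := φ (p a) with hu
  set D := φ d with hD
  have hlu : l ≤ u := (hφ a).1
  have hφq : ∀ v, φ (q v) = v.1 * D + φ (p v.2) := fun v => by simp [hq, hD]
  have band : ∀ r s : ℕ, r < s → ((r : ℝ) + 1) * D ≤ s * D := fun r s hrs =>
    mul_le_mul_of_nonneg_right (by exact_mod_cast hrs) (by linarith)
  have hvert : ∀ v, v.1 * D + l ≤ φ (q v) ∧ φ (q v) ≤ v.1 * D + u := fun v => by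
    rw [hφq]; constructor <;> linarith [hφ v.2]
  have hcopy : ∀ (r : Fin k) (x y : C), ∀ z ∈ openSegment ℝ (q (r, x)) (q (r, y)),
      r * D + l ≤ φ z ∧ φ z ≤ r * D + u := fun r x y z hz =>
    map_openSegment_mem_Icc φ (hvert (r, x)) (hvert (r, y)) hz
  have hlink : ∀ v w : Fin k × C, (v.1 : ℕ) + 1 = w.1 → v.2 = a → w.2 = b →
      ∀ z ∈ openSegment ℝ (q v) (q w), v.1 * D + u < φ z ∧ φ z < (v.1 + 1) * D + l := by
    intro v w hvw hv hw z hz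
    have h2 : (w.1 : ℝ) = v.1 + 1 := by exact_mod_cast hvw.symm
    refine map_openSegment_mem_Ioo φ (by rw [hφq, hv]) (by rw [hφq, hw, h2]) ?_ hz
    linarith
  have sep : ∀ (r s : ℕ) (x : ℝ), r * D + l ≤ x → x ≤ r * D + u → s * D + l ≤ x →
      x ≤ s * D + u → r = s := by
    intro r s x h1 h2 h3 h4
    rcases lt_trichotomy r s with hrs | hrs | hrs
    · linarith [band r s hrs]
    · exact hrs
    · linarith [band s r hrs]
  have sep' : ∀ (r s : ℕ) (x : ℝ), r * D + l ≤ x → x ≤ r * D + u → s * D + u < x →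
      x < (s + 1) * D + l → False := by
    intro r s x h1 h2 h3 h4
    rcases lt_or_ge s r with hrs | hrs
    · linarith [band s r hrs]
    · have : (r : ℝ) * D ≤ s * D :=
        mul_le_mul_of_nonneg_right (by exact_mod_cast hrs) (by linarith)
      linarith
  have sep'' : ∀ (r s : ℕ) (x : ℝ), r * D + u < x → x < (r + 1) * D + l → s * D + u < x →
      x < (s + 1) * D + l → r = s := by
    intro r s x h1 h2 h3 h4
    rcases lt_trichotomy r s with hrs | hrs | hrs
    · linarith [band r s hrs]
    · exact hrs
    · linarith [band s r hrs]
  have hshift : ∀ (r : Fin k) (x y : C),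
      openSegment ℝ (q (r, x)) (q (r, y)) =
        (fun z => (r : ℝ) • d + z) '' openSegment ℝ (p x) (p y) := fun r x y =>
    (openSegment_translate_image ℝ _ _ _).symm
  -- Case analysis on an edge up to orientation: inside a copy, or a link.
  have cases : ∀ (P : Fin k × C → Fin k × C → Prop), (∀ v w, P v w → P w v) →
      (∀ r x y, G.Adj x y → P (r, x) (r, y)) →
      (∀ v w : Fin k × C, (v.1 : ℕ) + 1 = w.1 → v.2 = a → w.2 = b → P v w) →
      ∀ v w, (_root_.chainGraph G a b k).Adj v w → P v w := by
    rintro P hs h1 h2 ⟨r, x⟩ ⟨r', y⟩ (⟨h, h'⟩ | h | h)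
    · obtain rfl : r = r' := h
      exact h1 r x y h'
    · exact h2 _ _ h.1 h.2.1 h.2.2
    · exact hs _ _ (h2 _ _ h.1 h.2.1 h.2.2)
  refine ⟨?_, ?_, ?_⟩
  · rintro v w hvw
    have hv := hvert v
    rw [hvw] at hv
    have h1 : v.1 = w.1 := Fin.ext (sep _ _ _ hv.1 hv.2 (hvert w).1 (hvert w).2)
    refine Prod.ext h1 (h.injective ?_)
    simpa [hq, h1] using hvw
  · intro v w x
    refine cases (fun v w => q x ∉ openSegment ℝ (q v) (q w)) ?_ ?_ ?_ v w
    · intro v w h; rwa [openSegment_symm]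
    · intro r y y' hy hx
      have h1 := hcopy _ _ _ _ hx
      obtain rfl : r = x.1 := Fin.ext (sep _ _ _ h1.1 h1.2 (hvert x).1 (hvert x).2)
      rw [hshift] at hx
      obtain ⟨z, hz, hzx⟩ := hx
      obtain rfl : z = p x.2 := add_left_cancel hzx
      exact h.notMem_openSegment _ _ _ hy hz
    · intro v w hvw hv hw hx
      have h1 := hlink v w hvw hv hw _ hx
      exact sep' _ _ _ (hvert x).1 (hvert x).2 h1.1 h1.2
  · intro v w v' w' hvw
    revert v w
    refine cases (fun v w => (_root_.chainGraph G a b k).Adj v' w' → s(v, w) ≠ s(v', w') →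
      Disjoint (openSegment ℝ (q v) (q w)) (openSegment ℝ (q v') (q w'))) ?_ ?_ ?_
    · intro v w h h1 h2
      rw [openSegment_symm]
      exact h h1 (by rwa [Sym2.eq_swap])
    · intro r x y hxy
      revert v' w'
      refine cases (fun v' w' => s((r, x), (r, y)) ≠ s(v', w') →
        Disjoint (openSegment ℝ (q (r, x)) (q (r, y))) (openSegment ℝ (q v') (q w'))) ?_ ?_ ?_
      · intro v w h h2
        rw [openSegment_symm ℝ (q w)]
        exact h (by rwa [Sym2.eq_swap (a := v)])
      · intro r' x' y' hxy' hne
        rw [disjoint_left]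
        intro z hz hz'
        have h1 := hcopy _ _ _ _ hz
        have h2 := hcopy _ _ _ _ hz'
        obtain rfl : r = r' := Fin.ext (sep _ _ _ h1.1 h1.2 h2.1 h2.2)
        rw [hshift] at hz hz'
        obtain ⟨z, hz, rfl⟩ := hz
        obtain ⟨z', hz', hzz⟩ := hz'
        obtain rfl : z' = z := add_left_cancel hzz
        refine disjoint_left.1 (h.disjoint_openSegment _ _ _ _ hxy hxy' ?_) hz hz'
        intro he
        apply hne
        simpa using congrArg (Sym2.map fun x => (r, x)) he
      · intro v w hvw hv hw _
        rw [disjoint_left]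
        intro z hz hz'
        have h1 := hcopy _ _ _ _ hz
        have h2 := hlink v w hvw hv hw _ hz'
        exact sep' _ _ _ h1.1 h1.2 h2.1 h2.2
    · intro v w hvw hv hw
      revert v' w'
      refine cases (fun v' w' => s(v, w) ≠ s(v', w') →
        Disjoint (openSegment ℝ (q v) (q w)) (openSegment ℝ (q v') (q w'))) ?_ ?_ ?_
      · intro v' w' h h2
        rw [openSegment_symm ℝ (q w')]
        exact h (by rwa [Sym2.eq_swap (a := v')])
      · intro r' x' y' hxy' _
        rw [disjoint_left]
        intro z hz hz'
        have h1 := hcopy _ _ _ _ hz'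
        have h2 := hlink v w hvw hv hw _ hz
        exact sep' _ _ _ h1.1 h1.2 h2.1 h2.2
      · intro v' w' hvw' hv' hw' hne
        rw [disjoint_left]
        intro z hz hz'
        have h1 := hlink v w hvw hv hw _ hz
        have h2 := hlink v' w' hvw' hv' hw' _ hz'
        have h3 := sep'' _ _ _ h1.1 h1.2 h2.1 h2.2
        apply hne
        have e1 : v = v' := Prod.ext (Fin.ext h3) (hv.trans hv'.symm)
        have e2 : w = w' := Prod.ext (Fin.ext (by omega)) (hw.trans hw'.symm)
        rw [e1, e2]

/-! ### The icosahedron in the plane: cells and separating lines. -/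

/-- The six disjoint edges of the icosahedron which are subdivided into long paths. -/
abbrev LongPath := Fin 3 × Bool

/-- First coordinates of the two ends of the long paths. -/
def endX : LongPath × Bool → ℤ
  | ((0, false), false) => 0
  | ((0, false), true) => 5
  | ((0, true), false) => 4
  | ((0, true), true) => 5
  | ((1, false), false) => 12
  | ((1, false), true) => 6
  | ((1, true), false) => 3
  | ((1, true), true) => 4
  | ((2, false), false) => 1
  | ((2, false), true) => 2
  | ((2, true), false) => 7
  | ((2, true), true) => 5

/-- Second coordinates of the two ends of the long paths. -/
def endY : LongPath × Bool → ℤ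
  | ((0, false), false) => 0
  | ((0, false), true) => 2
  | ((0, true), false) => 6
  | ((0, true), true) => 4
  | ((1, false), false) => 0
  | ((1, false), true) => 4
  | ((1, true), false) => 3
  | ((1, true), true) => 4
  | ((2, false), false) => 12
  | ((2, false), true) => 5
  | ((2, true), false) => 2
  | ((2, true), true) => 3

/-- The two vertices of the icosahedron which are opposite to a subdivided edge in the two faces
containing this edge. -/
def apex (s : LongPath) (δ : Bool) : LongPath × Bool := ((s.1 + 1, δ), s.2)

/-- The orientation of a triangle whose corners are ends of long paths. -/
def orient (u v w : LongPath × Bool) : ℤ :=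
  (endX v - endX u) * (endY w - endY u) - (endY v - endY u) * (endX w - endX u)

/-- The cell of a long path (`none`), or of a face containing it (`some δ`), lies strictly to the
left of the line from `u` to `v`. -/
def isLeft (u v : LongPath × Bool) : LongPath × Option Bool → Bool
  | (s, none) => 0 < orient u v (s, false) && 0 < orient u v (s, true)
  | (s, some δ) => 0 ≤ orient u v (s, false) && 0 ≤ orient u v (s, true) &&
      0 ≤ orient u v (apex s δ) && (0 < orient u v (apex s δ) ||
        (0 < orient u v (s, false) && 0 < orient u v (s, true)))

/-- The cell of a long path, or of a face containing it, does not meet the left side of the line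
from `u` to `v`. -/
def isRight (u v : LongPath × Bool) : LongPath × Option Bool → Bool
  | (s, none) => orient u v (s, false) ≤ 0 && orient u v (s, true) ≤ 0
  | (s, some δ) => orient u v (s, false) ≤ 0 && orient u v (s, true) ≤ 0 &&
      orient u v (apex s δ) ≤ 0

/-- The 18 cells are the six matching edges and the twelve faces containing them. For each pair some
line through two corners has one cell strictly on one side and the other on the closed opposite
side, which still allows common boundary. -/
theorem exists_separating_line : ∀ c c' : LongPath × Option Bool, c ≠ c' →
    ∃ u v, (isLeft u v c && isRight u v c' || isLeft u v c' && isRight u v c) = true := by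
  decide +kernel

theorem orient_apex_ne_zero : ∀ (s : LongPath) (δ : Bool),
    orient (s, false) (s, true) (apex s δ) ≠ 0 := by
  decide +kernel

theorem end_coordinates_ne : ∀ s : LongPath,
    endX (s, false) ≠ endX (s, true) ∨ endY (s, false) ≠ endY (s, true) := by
  decide +kernel

/-- The links of the chain are attached at these leftmost and rightmost corners. -/
theorem endX_mem_Icc : ∀ w, endX ((0, false), false) ≤ endX w ∧
    endX w ≤ endX ((1, false), false) := by
  decide +kernel

/-- The position in the plane of an end of a long path. -/
noncomputable def corner (w : LongPath × Bool) : EuclideanSpace ℝ (Fin 2) :=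
  !₂[(endX w : ℝ), (endY w : ℝ)]

theorem corner_ne (s : LongPath) : corner (s, false) ≠ corner (s, true) := by
  intro h
  have h0 := congrFun (congrArg WithLp.ofLp h) 0
  have h1 := congrFun (congrArg WithLp.ofLp h) 1
  simp only [corner, Matrix.cons_val_zero, Matrix.cons_val_one, Int.cast_inj] at h0 h1
  exact (end_coordinates_ne s).elim (fun h => h h0) fun h => h h1

/-- The signed side of a point with respect to the line from `u` to `v`. -/
noncomputable def side (u v : LongPath × Bool) (z : EuclideanSpace ℝ (Fin 2)) : ℝ :=
  (endX v - endX u) * (z 1 - endY u) - (endY v - endY u) * (z 0 - endX u)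

theorem side_corner (u v w : LongPath × Bool) : side u v (corner w) = orient u v w := by
  simp [side, corner, orient]

theorem side_combination (u v : LongPath × Bool) (x y : EuclideanSpace ℝ (Fin 2)) {α β : ℝ}
    (h : α + β = 1) : side u v (α • x + β • y) = α * side u v x + β * side u v y := by
  obtain rfl : α = 1 - β := by linarith
  simp only [side, PiLp.add_apply, PiLp.smul_apply, smul_eq_mul]
  ring

/-- The closed segment of a long path, or a face containing it without this segment and without
the opposite vertex. -/
def cell : LongPath × Option Bool → Set (EuclideanSpace ℝ (Fin 2))
  | (s, none) => segment ℝ (corner (s, false)) (corner (s, true))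
  | (s, some δ) => {z | ∃ y ∈ segment ℝ (corner (s, false)) (corner (s, true)),
      z ∈ openSegment ℝ (corner (apex s δ)) y}

theorem side_pos_of_mem_segment {u v : LongPath × Bool} {x y z : EuclideanSpace ℝ (Fin 2)}
    (hx : 0 < side u v x) (hy : 0 < side u v y) (hz : z ∈ segment ℝ x y) : 0 < side u v z := by
  obtain ⟨α, β, hα, hβ, h, rfl⟩ := hz
  rw [side_combination u v x y h]
  rcases hα.eq_or_lt with rfl | hα
  · obtain rfl : β = 1 := by linarith
    simpa using hy
  · have := mul_pos hα hx
    have := mul_nonneg hβ hy.le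
    linarith

theorem side_nonneg_of_mem_segment {u v : LongPath × Bool} {x y z : EuclideanSpace ℝ (Fin 2)}
    (hx : 0 ≤ side u v x) (hy : 0 ≤ side u v y) (hz : z ∈ segment ℝ x y) : 0 ≤ side u v z := by
  obtain ⟨α, β, hα, hβ, h, rfl⟩ := hz
  rw [side_combination u v x y h]
  positivity

theorem side_nonpos_of_mem_segment {u v : LongPath × Bool} {x y z : EuclideanSpace ℝ (Fin 2)}
    (hx : side u v x ≤ 0) (hy : side u v y ≤ 0) (hz : z ∈ segment ℝ x y) : side u v z ≤ 0 := by
  obtain ⟨α, β, hα, hβ, h, rfl⟩ := hz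
  rw [side_combination u v x y h]
  have := mul_nonpos_of_nonneg_of_nonpos hα hx
  have := mul_nonpos_of_nonneg_of_nonpos hβ hy
  linarith

theorem side_pos_of_isLeft {u v : LongPath × Bool} {c : LongPath × Option Bool}
    (h : isLeft u v c = true) {z : EuclideanSpace ℝ (Fin 2)} (hz : z ∈ cell c) :
    0 < side u v z := by
  have cast : ∀ w, 0 < orient u v w → 0 < side u v (corner w) := fun w hw => by
    rw [side_corner]; exact_mod_cast hw
  have cast' : ∀ w, 0 ≤ orient u v w → 0 ≤ side u v (corner w) := fun w hw => by
    rw [side_corner]; exact_mod_cast hw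
  rcases c with ⟨s, _ | δ⟩
  · simp only [isLeft, Bool.and_eq_true, decide_eq_true_eq] at h
    exact side_pos_of_mem_segment (cast _ h.1) (cast _ h.2) hz
  · simp only [isLeft, Bool.and_eq_true, Bool.or_eq_true, decide_eq_true_eq] at h
    obtain ⟨⟨⟨h1, h2⟩, h3⟩, h4⟩ := h
    obtain ⟨y, hy, α, β, hα, hβ, hαβ, rfl⟩ := hz
    rw [side_combination u v _ y hαβ]
    -- Both weights are positive in a face cell, so strictness at the apex alone, or on the base
    -- alone, is enough.
    rcases h4 with h4 | ⟨h4, h5⟩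
    · have := mul_pos hα (cast _ h4)
      have := mul_nonneg hβ.le (side_nonneg_of_mem_segment (cast' _ h1) (cast' _ h2) hy)
      linarith
    · have := mul_nonneg hα.le (cast' _ h3)
      have := mul_pos hβ (side_pos_of_mem_segment (cast _ h4) (cast _ h5) hy)
      linarith

theorem side_nonpos_of_isRight {u v : LongPath × Bool} {c : LongPath × Option Bool}
    (h : isRight u v c = true) {z : EuclideanSpace ℝ (Fin 2)} (hz : z ∈ cell c) :
    side u v z ≤ 0 := by
  have cast : ∀ w, orient u v w ≤ 0 → side u v (corner w) ≤ 0 := fun w hw => by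
    rw [side_corner]; exact_mod_cast hw
  rcases c with ⟨s, _ | δ⟩
  · simp only [isRight, Bool.and_eq_true, decide_eq_true_eq] at h
    exact side_nonpos_of_mem_segment (cast _ h.1) (cast _ h.2) hz
  · simp only [isRight, Bool.and_eq_true, decide_eq_true_eq] at h
    obtain ⟨⟨h1, h2⟩, h3⟩ := h
    obtain ⟨y, hy, hz⟩ := hz
    exact side_nonpos_of_mem_segment (cast _ h3)
      (side_nonpos_of_mem_segment (cast _ h1) (cast _ h2) hy) (openSegment_subset_segment _ _ _ hz)

theorem disjoint_cell {c c' : LongPath × Option Bool} (h : c ≠ c') :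
    Disjoint (cell c) (cell c') := by
  obtain ⟨u, v, huv⟩ := exists_separating_line c c' h
  simp only [Bool.or_eq_true, Bool.and_eq_true] at huv
  rw [disjoint_left]
  intro z hz hz'
  rcases huv with ⟨h1, h2⟩ | ⟨h1, h2⟩
  · exact (side_pos_of_isLeft h1 hz).not_ge (side_nonpos_of_isRight h2 hz')
  · exact (side_pos_of_isLeft h1 hz').not_ge (side_nonpos_of_isRight h2 hz)

/-! ### The subdivided icosahedron and its drawing. -/

/-- The end of a path on `Fin n` given by a Boolean. -/
def endIndex (n : ℕ) (e : Bool) : ℕ := if e then n - 1 else 0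

/-- The icosahedron in which the edges of a perfect matching are subdivided into paths with `n`
vertices, all of which are joined to the two vertices opposite to the edge. -/
def subdividedIcosahedron (n : ℕ) : SimpleGraph (LongPath × Fin n) :=
  SimpleGraph.fromRel fun v w => (v.1 = w.1 ∧ (v.2 : ℕ) + 1 = w.2) ∨
    (w.1.1 = v.1.1 + 1 ∧ (w.2 : ℕ) = endIndex n v.1.2)

/-- The position in the plane of a vertex of the subdivided icosahedron. -/
noncomputable def position (n : ℕ) (v : LongPath × Fin n) : EuclideanSpace ℝ (Fin 2) :=
  AffineMap.lineMap (corner (v.1, false)) (corner (v.1, true)) ((v.2 : ℝ) / (n - 1))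

theorem position_mem_cell {n : ℕ} (hn : 2 ≤ n) (v : LongPath × Fin n) :
    position n v ∈ cell (v.1, none) := by
  have h1 : (2 : ℝ) ≤ n := by exact_mod_cast hn
  have h2 : ((v.2 : ℕ) : ℝ) + 1 ≤ n := by exact_mod_cast v.2.2
  rw [cell, segment_eq_image_lineMap]
  refine ⟨_, ⟨by apply div_nonneg <;> [positivity; linarith], ?_⟩, rfl⟩
  rw [div_le_one (by linarith)]
  linarith

theorem position_eq_corner {n : ℕ} (hn : 2 ≤ n) (v : LongPath × Fin n) {e : Bool}
    (h : (v.2 : ℕ) = endIndex n e) :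
    position n v = corner (v.1, e) := by
  have h1 : (2 : ℝ) ≤ n := by exact_mod_cast hn
  have h2 : ((n - 1 : ℕ) : ℝ) = n - 1 := by push_cast [Nat.cast_sub (by omega : 1 ≤ n)]; rfl
  rw [position, h]
  cases e
  · simp [endIndex]
  · rw [endIndex, if_pos rfl, h2, div_self (by linarith)]
    simp

theorem position_injective {n : ℕ} (hn : 2 ≤ n) : Function.Injective (position n) := by
  intro v w h
  have h1 : (2 : ℝ) ≤ n := by exact_mod_cast hn
  have hs : v.1 = w.1 := by
    by_contra hne
    refine disjoint_left.1 (disjoint_cell (c := (v.1, none)) (c' := (w.1, none)) ?_)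
      (position_mem_cell hn v) (h ▸ position_mem_cell hn w)
    simpa using hne
  rw [position, position, hs] at h
  have h3 := AffineMap.lineMap_injective ℝ (corner_ne w.1) h
  rw [div_left_inj' (by linarith)] at h3
  exact Prod.ext hs (Fin.ext (by exact_mod_cast h3))

theorem openSegment_position_subset_cell_none {n : ℕ} (hn : 2 ≤ n) {v w : LongPath × Fin n}
    (hs : v.1 = w.1) :
    openSegment ℝ (position n v) (position n w) ⊆ cell (v.1, none) :=
  (openSegment_subset_segment _ _ _).trans
    ((convex_segment _ _).segment_subset (position_mem_cell hn v) (hs ▸ position_mem_cell hn w))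

theorem openSegment_position_subset_cell_some {n : ℕ} (hn : 2 ≤ n) {v w : LongPath × Fin n}
    (h : w.1.1 = v.1.1 + 1 ∧ (w.2 : ℕ) = endIndex n v.1.2) :
    openSegment ℝ (position n v) (position n w) ⊆ cell (v.1, some w.1.2) := by
  intro z hz
  rw [openSegment_symm, position_eq_corner hn w h.2] at hz
  have : (w.1, v.1.2) = apex v.1 w.1.2 := by rw [apex, ← h.1]
  exact ⟨_, position_mem_cell hn v, this ▸ hz⟩

/-- The parameter `τ` extends the index along the path to real values, so that distinct edges of one
path occupy disjoint unit intervals. -/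
theorem exists_lineMap_of_mem_openSegment {n : ℕ} {v w : LongPath × Fin n} (hs : v.1 = w.1)
    (ht : (v.2 : ℕ) + 1 = w.2) {z : EuclideanSpace ℝ (Fin 2)}
    (hz : z ∈ openSegment ℝ (position n v) (position n w)) :
    ∃ τ : ℝ, z = AffineMap.lineMap (corner (v.1, false)) (corner (v.1, true)) (τ / (n - 1)) ∧
      (v.2 : ℝ) < τ ∧ τ < (v.2 : ℝ) + 1 := by
  rw [openSegment_eq_image_lineMap] at hz
  obtain ⟨θ, ⟨h0, h1⟩, rfl⟩ := hz
  have h2 : ((w.2 : ℕ) : ℝ) = v.2 + 1 := by exact_mod_cast ht.symm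
  refine ⟨v.2 + θ, ?_, by linarith, by linarith⟩
  rw [position, position, ← hs, h2, ← AffineMap.apply_lineMap]
  congr 1
  simp only [AffineMap.lineMap_apply, vsub_eq_sub, vadd_eq_add, smul_eq_mul]
  ring

theorem lineMap_corner_inj {n : ℕ} (hn : 2 ≤ n) {s : LongPath} {τ τ' : ℝ}
    (h : AffineMap.lineMap (corner (s, false)) (corner (s, true)) (τ / (n - 1)) =
      AffineMap.lineMap (corner (s, false)) (corner (s, true)) (τ' / ((n : ℝ) - 1))) : τ = τ' := by
  have h1 : (2 : ℝ) ≤ n := by exact_mod_cast hn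
  have h3 := AffineMap.lineMap_injective ℝ (corner_ne s) h
  rwa [div_left_inj' (by linarith)] at h3

theorem side_eq_zero_of_mem_cell_none {s : LongPath} {y : EuclideanSpace ℝ (Fin 2)}
    (hy : y ∈ cell (s, none)) : side (s, false) (s, true) y = 0 := by
  obtain ⟨α, β, -, -, h, rfl⟩ := hy
  rw [side_combination _ _ _ _ h, side_corner, side_corner]
  simp only [orient]
  push_cast
  ring

/-- `side` vanishes on the base but not at the apex, so its value at `z` determines the weight of
the apex and hence the point on the base. Spokes from one apex therefore do not meet elsewhere. -/
theorem eq_of_mem_openSegment_apex {s : LongPath} {δ : Bool} {y y' z : EuclideanSpace ℝ (Fin 2)}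
    (hy : y ∈ cell (s, none)) (hy' : y' ∈ cell (s, none))
    (hz : z ∈ openSegment ℝ (corner (apex s δ)) y)
    (hz' : z ∈ openSegment ℝ (corner (apex s δ)) y') : y = y' := by
  obtain ⟨α, β, hα, hβ, h, rfl⟩ := hz
  obtain ⟨α', β', hα', hβ', h', hz⟩ := hz'
  have h1 := congrArg (side (s, false) (s, true)) hz
  rw [side_combination _ _ _ _ h, side_combination _ _ _ _ h', side_eq_zero_of_mem_cell_none hy,
    side_eq_zero_of_mem_cell_none hy', side_corner] at h1
  have h2 : (orient (s, false) (s, true) (apex s δ) : ℝ) ≠ 0 := by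
    exact_mod_cast orient_apex_ne_zero s δ
  obtain rfl : α' = α := mul_right_cancel₀ h2 (by linarith)
  obtain rfl : β' = β := by linarith
  exact (smul_right_injective _ hβ.ne' (add_left_cancel hz)).symm

theorem subdividedIcosahedron_cases {n : ℕ}
    (P : LongPath × Fin n → LongPath × Fin n → Prop) (hsymm : ∀ v w, P v w → P w v)
    (hpath : ∀ v w, v.1 = w.1 → (v.2 : ℕ) + 1 = w.2 → P v w)
    (hspoke : ∀ v w, w.1.1 = v.1.1 + 1 ∧ (w.2 : ℕ) = endIndex n v.1.2 → P v w) :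
    ∀ v w, (subdividedIcosahedron n).Adj v w → P v w := by
  rintro v w ⟨-, (h | h) | (h | h)⟩
  · exact hpath _ _ h.1 h.2
  · exact hspoke _ _ h
  · exact hsymm _ _ (hpath _ _ h.1 h.2)
  · exact hsymm _ _ (hspoke _ _ h)

theorem isStraightDrawing_subdividedIcosahedron {n : ℕ} (hn : 2 ≤ n) :
    IsStraightDrawing (subdividedIcosahedron n) (position n) := by
  have hne : ∀ {s s' : LongPath} {δ : Bool},
      ((s, none) : LongPath × Option Bool) ≠ (s', some δ) := by
    simp
  refine ⟨position_injective hn, ?_, ?_⟩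
  · intro v w x
    refine subdividedIcosahedron_cases
      (fun v w => position n x ∉ openSegment ℝ (position n v) (position n w)) ?_ ?_ ?_ v w
    · intro v w h; rwa [openSegment_symm]
    · intro v w hs ht hx
      have h1 : x.1 = v.1 := by
        by_contra hne
        refine disjoint_left.1 (disjoint_cell (c := (x.1, none)) (c' := (v.1, none)) ?_)
          (position_mem_cell hn x) (openSegment_position_subset_cell_none hn hs hx)
        simpa using hne
      obtain ⟨τ, h2, h3, h4⟩ := exists_lineMap_of_mem_openSegment hs ht hx
      rw [position, h1] at h2
      obtain rfl := lineMap_corner_inj hn h2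
      have h3 : (v.2 : ℕ) < x.2 := by exact_mod_cast h3
      have h4 : (x.2 : ℕ) < v.2 + 1 := by exact_mod_cast h4
      omega
    · intro v w h hx
      exact disjoint_left.1 (disjoint_cell hne) (position_mem_cell hn x)
        (openSegment_position_subset_cell_some hn h hx)
  · intro v w v' w' hvw
    revert v w
    refine subdividedIcosahedron_cases (fun v w => (subdividedIcosahedron n).Adj v' w' →
      s(v, w) ≠ s(v', w') → Disjoint (openSegment ℝ (position n v) (position n w))
        (openSegment ℝ (position n v') (position n w'))) ?_ ?_ ?_
    · intro v w h h1 h2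
      rw [openSegment_symm]
      exact h h1 (by rwa [Sym2.eq_swap])
    · intro v w hs ht
      revert v' w'
      refine subdividedIcosahedron_cases (fun v' w' => s(v, w) ≠ s(v', w') →
        Disjoint (openSegment ℝ (position n v) (position n w))
          (openSegment ℝ (position n v') (position n w'))) ?_ ?_ ?_
      · intro v' w' h h2
        rw [openSegment_symm ℝ (position n w')]
        exact h (by rwa [Sym2.eq_swap (a := v')])
      · intro v' w' hs' ht' hne
        rw [disjoint_left]
        intro z hz hz'
        have h1 : v.1 = v'.1 := by
          by_contra hne
          refine disjoint_left.1 (disjoint_cell (c := (v.1, none)) (c' := (v'.1, none)) ?_)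
            (openSegment_position_subset_cell_none hn hs hz)
            (openSegment_position_subset_cell_none hn hs' hz')
          simpa using hne
        obtain ⟨τ, h2, h3, h4⟩ := exists_lineMap_of_mem_openSegment hs ht hz
        obtain ⟨τ', h2', h3', h4'⟩ := exists_lineMap_of_mem_openSegment hs' ht' hz'
        rw [h2, h1] at h2'
        obtain rfl := lineMap_corner_inj hn h2'
        have h5 : (v.2 : ℕ) < v'.2 + 1 := by exact_mod_cast h3.trans h4'
        have h6 : (v'.2 : ℕ) < v.2 + 1 := by exact_mod_cast h3'.trans h4
        have e1 : v = v' := Prod.ext h1 (Fin.ext (by omega))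
        have e2 : w = w' := Prod.ext (by rw [← hs, ← hs', h1]) (Fin.ext (by omega))
        exact hne (by rw [e1, e2])
      · intro v' w' h' _
        exact (disjoint_cell hne).mono (openSegment_position_subset_cell_none hn hs)
          (openSegment_position_subset_cell_some hn h')
    · intro v w h
      revert v' w'
      refine subdividedIcosahedron_cases (fun v' w' => s(v, w) ≠ s(v', w') →
        Disjoint (openSegment ℝ (position n v) (position n w))
          (openSegment ℝ (position n v') (position n w'))) ?_ ?_ ?_
      · intro v' w' h h2
        rw [openSegment_symm ℝ (position n w')]
        exact h (by rwa [Sym2.eq_swap (a := v')])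
      · intro v' w' hs' ht' _
        exact (disjoint_cell hne.symm).mono (openSegment_position_subset_cell_some hn h)
          (openSegment_position_subset_cell_none hn hs')
      · intro v' w' h' hne
        -- Two spokes in the same face share their apex; spokes in different faces lie in disjoint
        -- cells.
        by_cases hc : ((v.1, some w.1.2) : LongPath × Option Bool) = (v'.1, some w'.1.2)
        · rw [disjoint_left]
          intro z hz hz'
          obtain ⟨h1, h2⟩ := Prod.ext_iff.1 hc
          simp only [Option.some.injEq] at h1 h2
          have hw : w = w' := by
            refine Prod.ext (Prod.ext ?_ h2) (Fin.ext ?_)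
            · rw [h.1, h'.1, h1]
            · rw [h.2, h'.2, h1]
          have ha : position n w = corner (apex v.1 w.1.2) := by
            rw [position_eq_corner hn w h.2, apex, ← h.1]
          subst hw
          rw [openSegment_symm, ha] at hz hz'
          have h3 := eq_of_mem_openSegment_apex (position_mem_cell hn v)
            (h1 ▸ position_mem_cell hn v') hz hz'
          exact hne (by rw [position_injective hn h3])
        · exact (disjoint_cell hc).mono (openSegment_position_subset_cell_some hn h)
            (openSegment_position_subset_cell_some hn h')

theorem position_coordinate_mem_Icc {n : ℕ} (hn : 2 ≤ n) (v : LongPath × Fin n) :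
    (0 : ℝ) ≤ position n v 0 ∧ position n v 0 ≤ 12 := by
  have h : ∀ w, (0 : ℝ) ≤ corner w 0 ∧ corner w 0 ≤ 12 := fun w => by
    have := endX_mem_Icc w
    simp only [endX] at this
    simpa [corner] using (by exact_mod_cast this : (0 : ℝ) ≤ endX w ∧ (endX w : ℝ) ≤ 12)
  obtain ⟨α, β, hα, hβ, hαβ, hz⟩ := position_mem_cell hn v
  rw [← hz]
  simp only [PiLp.add_apply, PiLp.smul_apply, smul_eq_mul]
  have h1 := h (v.1, false)
  have h2 := h (v.1, true)
  obtain rfl : α = 1 - β := by linarith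
  constructor <;> nlinarith

theorem subdividedIcosahedron_connected {n : ℕ} (hn : 2 ≤ n) :
    (subdividedIcosahedron n).Connected := by
  have hspoke : ∀ v w : LongPath × Fin n,
      w.1.1 = v.1.1 + 1 ∧ (w.2 : ℕ) = endIndex n v.1.2 →
        (subdividedIcosahedron n).Reachable v w := by
    intro v w h
    refine SimpleGraph.Adj.reachable ⟨?_, Or.inl (Or.inr h)⟩
    rintro rfl
    have h1 : ∀ c : Fin 3, c ≠ c + 1 := by decide
    exact h1 _ h.1
  have hend : ∀ e, endIndex n e < n := by intro e; cases e <;> simp [endIndex] <;> omega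
  -- All vertices of a long path have a common neighbour, an apex.
  have same : ∀ (s : LongPath) (t t' : Fin n), (subdividedIcosahedron n).Reachable (s, t) (s, t') :=
    fun s t t' => (hspoke (s, t) ((s.1 + 1, true), ⟨_, hend s.2⟩) ⟨rfl, rfl⟩).trans
      (hspoke (s, t') _ ⟨rfl, rfl⟩).symm
  have next : ∀ (s : LongPath) (δ : Bool) (t t' : Fin n),
      (subdividedIcosahedron n).Reachable (s, t) ((s.1 + 1, δ), t') := fun s δ t t' =>
    (hspoke (s, t) ((s.1 + 1, δ), ⟨_, hend s.2⟩) ⟨rfl, rfl⟩).trans (same _ _ _)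
  let t₀ : Fin n := ⟨0, by omega⟩
  have all : ∀ v, (subdividedIcosahedron n).Reachable v ((0, true), t₀) := by
    rintro ⟨⟨c, b⟩, t⟩
    fin_cases c
    · exact (next (0, b) true t t₀).trans ((next (1, true) true t₀ t₀).trans
        (next (2, true) true t₀ t₀))
    · exact (next (1, b) true t t₀).trans (next (2, true) true t₀ t₀)
    · exact next (2, b) true t t₀
  have : Nonempty (LongPath × Fin n) := ⟨((0, true), t₀)⟩
  exact ⟨fun v w => (all v).trans (all w).symm⟩

/-! ### Zigzag paths on residues and the assignment of empires. -/

/-- The walk `0, -1, 1, -2, 2, …` through the integers. -/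
def zigzag (t : ℕ) : ℤ := if t % 2 = 0 then (t / 2 : ℕ) else -((t + 1) / 2 : ℕ)

theorem zigzag_two_mul (n : ℕ) : zigzag (2 * n) = n := by
  simp [zigzag]

theorem zigzag_two_mul_add_one (n : ℕ) : zigzag (2 * n + 1) = -(n + 1) := by
  have h1 : (2 * n + 1) % 2 ≠ 0 := by omega
  have h2 : (2 * n + 1 + 1) / 2 = n + 1 := by omega
  rw [zigzag, if_neg h1, h2]
  push_cast
  ring

section

variable (k : ℕ)

theorem natCast_add_self_eq_zero : (k : ZMod (2 * k)) + k = 0 := by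
  have := ZMod.natCast_self (2 * k)
  push_cast at this
  linear_combination this

/-- Even positions gain `k`, odd ones lose `k`, which agree modulo `2k`. Thus the second half of a
long zigzag is a translate of the first. -/
theorem zigzag_add_two_mul (t : ℕ) :
    (zigzag (t + 2 * k) : ZMod (2 * k)) = zigzag t + k := by
  have h := natCast_add_self_eq_zero k
  rcases Nat.even_or_odd' t with ⟨n, rfl | rfl⟩
  · rw [← mul_add, zigzag_two_mul, zigzag_two_mul]
    push_cast
    ring
  · rw [show 2 * n + 1 + 2 * k = 2 * (n + k) + 1 by ring, zigzag_two_mul_add_one,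
      zigzag_two_mul_add_one]
    push_cast
    linear_combination -h

/-- The empire of the vertex at position `t` of the long path `s` in the `r`-th component. -/
def pathEmpire (r : ℕ) (s : LongPath) (t : ℕ) : (Fin 3 × Bool) × ZMod (2 * k) :=
  -- On the path `(c, false)` the type alternates, so its edges join different types; on `(c, true)`
  -- it changes only at the middle edge, so each half is a zigzag within one type.
  ((s.1, if s.2 then decide (2 * k ≤ t) else decide (t % 2 = 1)),
    r + (if s.2 then (k : ZMod (2 * k)) else 0) + zigzag t)

end

section

variable {k : ℕ}

theorem exists_natCast_eq (hk : 0 < k) (x : ZMod (2 * k)) : ∃ n < 2 * k, (n : ZMod (2 * k)) = x := by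
  have : NeZero (2 * k) := ⟨by omega⟩
  exact ⟨x.val, x.val_lt, ZMod.natCast_zmod_val x⟩

theorem exists_natCast_add_eq (hk : 0 < k) (x : ZMod (2 * k)) :
    ∃ r < k, ∃ b : Bool, (r : ZMod (2 * k)) + (if b then (k : ZMod (2 * k)) else 0) = x := by
  obtain ⟨n, hn, rfl⟩ := exists_natCast_eq hk x
  rcases lt_or_ge n k with h | h
  · exact ⟨n, h, false, by simp⟩
  · refine ⟨n - k, by omega, true, ?_⟩
    rw [if_pos rfl]
    exact_mod_cast congrArg (Nat.cast (R := ZMod (2 * k))) (by omega : n - k + k = n)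

theorem exists_zigzag_eq (hk : 0 < k) (x : ZMod (2 * k)) :
    ∃ t < 2 * k, (zigzag t : ZMod (2 * k)) = x := by
  obtain ⟨n, hn, rfl⟩ := exists_natCast_eq hk x
  rcases lt_or_ge n k with h | h
  · exact ⟨2 * n, by omega, by simp [zigzag_two_mul]⟩
  · obtain ⟨j, hj⟩ : ∃ j, n + (j + 1) = k + k := ⟨k + k - n - 1, by omega⟩
    refine ⟨2 * j + 1, by omega, ?_⟩
    have h1 := congrArg (Nat.cast (R := ZMod (2 * k))) hj
    push_cast at h1
    rw [zigzag_two_mul_add_one]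
    push_cast
    linear_combination -natCast_add_self_eq_zero k - h1

/-- Every pair of residues is reflected at some `r < k` or at some `r - 1/2`. -/
theorem exists_reflection (hk : 0 < k) (x y : ZMod (2 * k)) :
    ∃ r < k, ∃ u < 2 * k, x = (r : ZMod (2 * k)) + u ∧
      (y = (r : ZMod (2 * k)) - u ∨ y = (r : ZMod (2 * k)) - u - 1) := by
  have h0 := natCast_add_self_eq_zero k
  obtain ⟨n, hn, h⟩ := exists_natCast_eq hk (x + y)
  -- Consecutive terms of the zigzag translated by `r` have sum `2r - 1` or `2r`; for `r < k` these
  -- sums are all the residues.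
  have aux : ∃ r < k, x + y = 2 * (r : ZMod (2 * k)) ∨ x + y = 2 * (r : ZMod (2 * k)) - 1 := by
    rcases Nat.even_or_odd' n with ⟨j, rfl | rfl⟩
    · exact ⟨j, by omega, Or.inl (by rw [← h]; push_cast; ring)⟩
    · rcases (by omega : j + 1 < k ∨ j + 1 = k) with hj | rfl
      · exact ⟨j + 1, hj, Or.inr (by rw [← h]; push_cast; ring)⟩
      · refine ⟨0, hk, Or.inr ?_⟩
        rw [← h]
        push_cast at h0 ⊢
        linear_combination h0
  obtain ⟨r, hr, hxy⟩ := aux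
  obtain ⟨u, hu, hxu⟩ := exists_natCast_eq hk (x - r)
  refine ⟨r, hr, u, hu, by rw [hxu]; ring, hxy.imp (fun h => ?_) fun h => ?_⟩
  · rw [hxu]; linear_combination h
  · rw [hxu]; linear_combination h

/-- The translates of the zigzag path by `r < k` decompose the complete graph on the residues. -/
theorem exists_zigzag_edge (hk : 0 < k) {x y : ZMod (2 * k)} (hxy : x ≠ y) :
    ∃ r < k, ∃ t, t + 1 < 2 * k ∧
      ((r + zigzag t = x ∧ r + zigzag (t + 1) = y) ∨
        ((r : ZMod (2 * k)) + zigzag t = y ∧ (r : ZMod (2 * k)) + zigzag (t + 1) = x)) := by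
  have h0 := natCast_add_self_eq_zero k
  obtain ⟨r, hr, u, hu, rfl, rfl | rfl⟩ := exists_reflection hk x y
  -- For `u = 0` and `u = k` the residues `r + u` and `r - u` coincide. For `u > k` the pair is
  -- traversed in the other direction, with `2k - u` in place of `u`.
  · rcases (by omega : u = 0 ∨ (0 < u ∧ u < k) ∨ u = k ∨ k < u) with rfl | ⟨h1, h2⟩ | rfl | h
    · simp at hxy
    · obtain ⟨j, rfl⟩ : ∃ j, u = j + 1 := ⟨u - 1, by omega⟩
      refine ⟨r, hr, 2 * j + 1, by omega, Or.inr ⟨?_, ?_⟩⟩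
      · rw [zigzag_two_mul_add_one]; push_cast; ring
      · rw [show 2 * j + 1 + 1 = 2 * (j + 1) by ring, zigzag_two_mul]; push_cast; ring
    · exact absurd (by linear_combination h0) hxy
    · obtain ⟨j, hj⟩ : ∃ j, u + (j + 1) = k + k := ⟨k + k - u - 1, by omega⟩
      have h1 := congrArg (Nat.cast (R := ZMod (2 * k))) hj
      push_cast at h1
      refine ⟨r, hr, 2 * j + 1, by omega, Or.inl ⟨?_, ?_⟩⟩
      · rw [zigzag_two_mul_add_one]; push_cast; linear_combination -h0 - h1
      · rw [show 2 * j + 1 + 1 = 2 * (j + 1) by ring, zigzag_two_mul]; push_cast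
        linear_combination h1 + h0
  · rcases lt_or_ge u k with h | h
    · refine ⟨r, hr, 2 * u, by omega, Or.inl ⟨?_, ?_⟩⟩
      · rw [zigzag_two_mul]; push_cast; ring
      · rw [zigzag_two_mul_add_one]; push_cast; ring
    · obtain ⟨j, hj⟩ : ∃ j, u + (j + 1) = k + k := ⟨k + k - u - 1, by omega⟩
      have h1 := congrArg (Nat.cast (R := ZMod (2 * k))) hj
      push_cast at h1
      refine ⟨r, hr, 2 * j, by omega, Or.inr ⟨?_, ?_⟩⟩
      · rw [zigzag_two_mul]; push_cast; linear_combination h1 + h0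
      · rw [zigzag_two_mul_add_one]; push_cast; linear_combination -h0 - h1

/-- For `b = false` the even positions run through `r + n` and the odd ones through `r - n - 1`,
with `n < 2k`. For `b = true` each half of the path runs through all residues. -/
theorem exists_pathEmpire_eq (hk : 0 < k) (r : ℕ) (c : Fin 3) (b ε : Bool) (x : ZMod (2 * k)) :
    ∃ t < 4 * k, pathEmpire k r (c, b) t = ((c, ε), x) := by
  have h0 := natCast_add_self_eq_zero k
  cases b
  · obtain ⟨n, hn, h⟩ := exists_natCast_eq hk (if ε then r - x - 1 else x - r)
    cases ε
    · refine ⟨2 * n, by omega, ?_⟩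
      simp only [Bool.false_eq_true, if_false] at h
      simp [pathEmpire, zigzag_two_mul, h]
    · refine ⟨2 * n + 1, by omega, ?_⟩
      simp only [if_true] at h
      have h2 : (2 * n + 1) % 2 = 1 := by omega
      simp [pathEmpire, zigzag_two_mul_add_one, h, h2]
      ring
  · obtain ⟨t, ht, h⟩ := exists_zigzag_eq hk (if ε then x - r else x - r - k)
    cases ε
    · refine ⟨t, by omega, ?_⟩
      simp only [Bool.false_eq_true, if_false] at h
      have h2 : ¬ 2 * k ≤ t := by omega
      simp only [pathEmpire, if_true, h, h2, decide_false, Prod.mk.injEq, true_and]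
      ring
    · refine ⟨t + 2 * k, by omega, ?_⟩
      simp only [if_true] at h
      simp only [pathEmpire, if_true, zigzag_add_two_mul, h, Prod.mk.injEq, true_and]
      exact ⟨by simp, by linear_combination h0⟩

/-- The zigzag takes the values `0` and `-2k` at the two ends, so both ends have the same residue
and differ only in type. -/
theorem pathEmpire_endIndex (hk : 0 < k) (r : ℕ) (c : Fin 3) (b e : Bool) :
    pathEmpire k r (c, b) (endIndex (4 * k) e) =
      ((c, e), (r : ZMod (2 * k)) + if b then (k : ZMod (2 * k)) else 0) := by
  have h0 := natCast_add_self_eq_zero k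
  obtain ⟨j, rfl⟩ : ∃ j, k = j + 1 := ⟨k - 1, by omega⟩
  cases e
  · cases b <;> simp [pathEmpire, endIndex, zigzag]
  · have h1 : endIndex (4 * (j + 1)) true = 2 * (2 * j + 1) + 1 := by simp [endIndex]; omega
    have h2 : 2 * (j + 1) ≤ 2 * (2 * j + 1) + 1 := by omega
    have h3 : (2 * (2 * j + 1) + 1) % 2 = 1 := by omega
    rw [h1, pathEmpire, zigzag_two_mul_add_one]
    have h4 : ((-((2 * j + 1 : ℕ) + 1) : ℤ) : ZMod (2 * (j + 1))) = 0 := by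
      push_cast at h0 ⊢
      linear_combination -h0
    simp only [h2, h3, h4, add_zero]
    cases b <;> simp

/-- Any two distinct empires of the same couple are met at consecutive vertices of a long path. -/
theorem exists_pathEmpire_eq_succ (hk : 0 < k) (c : Fin 3) {ε ε' : Bool} {x y : ZMod (2 * k)}
    (h : (ε, x) ≠ (ε', y)) :
    ∃ r < k, ∃ b t, t + 1 < 4 * k ∧
      ((pathEmpire k r (c, b) t = ((c, ε), x) ∧ pathEmpire k r (c, b) (t + 1) = ((c, ε'), y)) ∨
        (pathEmpire k r (c, b) t = ((c, ε'), y) ∧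
          pathEmpire k r (c, b) (t + 1) = ((c, ε), x))) := by
  have h0 := natCast_add_self_eq_zero k
  have mixed : ∀ x y : ZMod (2 * k), ∃ r < k, ∃ b t, t + 1 < 4 * k ∧
      ((pathEmpire k r (c, b) t = ((c, false), x) ∧
        pathEmpire k r (c, b) (t + 1) = ((c, true), y)) ∨
        (pathEmpire k r (c, b) t = ((c, true), y) ∧
          pathEmpire k r (c, b) (t + 1) = ((c, false), x))) := by
    intro x y
    obtain ⟨r, hr, u, hu, rfl, rfl | rfl⟩ := exists_reflection hk x y
    -- The pair with equal residues `r` would close the alternating path to a cycle and is missed by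
    -- it. The middle edge of the path `(c, true)`, from position `2k - 1` to `2k`, supplies it.
    · rcases Nat.eq_zero_or_pos u with rfl | hu0
      · obtain ⟨j, rfl⟩ : ∃ j, k = j + 1 := ⟨k - 1, by omega⟩
        refine ⟨r, hr, true, 2 * j + 1, by omega, Or.inl ⟨?_, ?_⟩⟩
        · have h2 : ¬ 2 * (j + 1) ≤ 2 * j + 1 := by omega
          simp only [pathEmpire, if_true, h2, decide_false, zigzag_two_mul_add_one]
          push_cast
          simp
          ring
        · rw [show 2 * j + 1 + 1 = 2 * (j + 1) by ring]
          simp only [pathEmpire, if_true, le_refl, decide_true, zigzag_two_mul]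
          push_cast at h0 ⊢
          simp only [Prod.mk.injEq, true_and]
          linear_combination h0
      · obtain ⟨j, rfl⟩ : ∃ j, u = j + 1 := ⟨u - 1, by omega⟩
        refine ⟨r, hr, false, 2 * j + 1, by omega, Or.inr ⟨?_, ?_⟩⟩
        · have h2 : (2 * j + 1) % 2 = 1 := by omega
          simp [pathEmpire, zigzag_two_mul_add_one, h2]
          ring
        · rw [show 2 * j + 1 + 1 = 2 * (j + 1) by ring]
          simp [pathEmpire, zigzag_two_mul]
    · refine ⟨r, hr, false, 2 * u, by omega, Or.inl ⟨?_, ?_⟩⟩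
      · simp [pathEmpire, zigzag_two_mul]
      · have h2 : (2 * u + 1) % 2 = 1 := by omega
        simp [pathEmpire, zigzag_two_mul_add_one, h2]
        ring
  cases ε <;> cases ε'
  -- The path `(c, true)` is shifted by `k`. In its second half this shift is cancelled by the `k`
  -- from `zigzag_add_two_mul`, so the case of two `true` types needs no correction.
  · have hxy : x - k ≠ y - k := fun e => h (by rw [sub_left_inj.1 e])
    obtain ⟨r, hr, t, ht, hrt⟩ := exists_zigzag_edge hk hxy
    have h1 : ¬ 2 * k ≤ t := by omega
    have h2 : ¬ 2 * k ≤ t + 1 := by omega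
    refine ⟨r, hr, true, t, by omega, ?_⟩
    simp only [pathEmpire, if_true, h1, h2, decide_false, Prod.mk.injEq, true_and]
    refine hrt.imp (And.imp ?_ ?_) (And.imp ?_ ?_) <;> intro h3 <;> linear_combination h3
  · exact mixed x y
  · obtain ⟨r, hr, b, t, ht, hrt⟩ := mixed y x
    exact ⟨r, hr, b, t, ht, hrt.symm⟩
  · have hxy : x ≠ y := fun e => h (by rw [e])
    obtain ⟨r, hr, t, ht, hrt⟩ := exists_zigzag_edge hk hxy
    refine ⟨r, hr, true, t + 2 * k, by omega, ?_⟩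
    have h1 : 2 * k ≤ t + 2 * k := by omega
    have h2 : 2 * k ≤ t + 1 + 2 * k := by omega
    rw [show t + 2 * k + 1 = t + 1 + 2 * k by ring]
    simp only [pathEmpire, if_true, h1, h2, decide_true, Prod.mk.injEq, true_and,
      zigzag_add_two_mul]
    refine hrt.imp (And.imp ?_ ?_) (And.imp ?_ ?_) <;> intro h3 <;> linear_combination h3 + h0

theorem pathEmpire_injOn {r : ℕ} {c c' : Fin 3} {b : Bool} {t t' : ℕ} (ht : t < 4 * k)
    (ht' : t' < 4 * k) (h : pathEmpire k r (c, b) t = pathEmpire k r (c', b) t') :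
    c = c' ∧ t = t' := by
  simp only [pathEmpire, Prod.mk.injEq, add_right_inj] at h
  obtain ⟨⟨hc, htype⟩, hz⟩ := h
  refine ⟨hc, ?_⟩
  rw [ZMod.intCast_eq_intCast_iff_dvd_sub] at hz
  push_cast at hz
  have small : ∀ d : ℤ, (2 * k : ℤ) ∣ d → -(2 * k) < d → d < 2 * k → d = 0 := fun d hd h1 h2 =>
    Int.eq_zero_of_abs_lt_dvd hd (abs_lt.2 ⟨h1, h2⟩)
  -- Zigzag values lie in `[-2k, 2k)`, so congruent ones differ by `0` or `±2k`; the types then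
  -- leave only equal positions.
  have s1 := small _ hz
  have s2 := small _ (dvd_sub hz (dvd_refl (2 * k : ℤ)))
  have s3 := small _ (dvd_add hz (dvd_refl (2 * k : ℤ)))
  unfold zigzag at s1 s2 s3
  cases b
  · simp only [Bool.false_eq_true, if_false, decide_eq_decide] at htype
    split_ifs at s1 <;> omega
  · simp only [if_true, decide_eq_decide] at htype
    split_ifs at s1 s2 s3 <;> omega

end

/-! ### Assembly of the complete planar graph. -/

theorem mainTheorem2 (m : ℕ) (hm : 2 ≤ m) (hmeven : Even m) :
    ∃ (V A : Type) (G : EmpireGraph V A), G.IsJ (6 * m) m ∧ G.graph.IsPlanarGraph := by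
  obtain ⟨k, rfl⟩ := hmeven
  have hk : 0 < k := by omega
  have hn : 2 ≤ 4 * k := by omega
  have : NeZero (2 * k) := ⟨by omega⟩
  let a : LongPath × Fin (4 * k) := ((1, false), ⟨0, by omega⟩)
  let b : LongPath × Fin (4 * k) := ((0, false), ⟨0, by omega⟩)
  let empire : Fin k × LongPath × Fin (4 * k) → (Fin 3 × Bool) × ZMod (2 * k) := fun v =>
    pathEmpire k v.1 v.2.1 v.2.2
  let G : EmpireGraph (Fin k × LongPath × Fin (4 * k)) ((Fin 3 × Bool) × ZMod (2 * k)) :=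
    { graph := chainGraph (subdividedIcosahedron (4 * k)) a b k
      empire := empire
      finite := inferInstance
      connected := chainGraph_connected (subdividedIcosahedron_connected hn) a b hk
      empire_surjective := by
        rintro ⟨⟨c, ε⟩, x⟩
        obtain ⟨t, ht, h⟩ := exists_pathEmpire_eq hk 0 c true ε x
        exact ⟨(⟨0, hk⟩, (c, true), ⟨t, ht⟩), h⟩ }
  have hspoke : ∀ (c c' : Fin 3) (ε ε' : Bool) (x y : ZMod (2 * k)), c' = c + 1 →
      ∃ v w, G.graph.Adj v w ∧ G.empire v = ((c, ε), x) ∧ G.empire w = ((c', ε'), y) := by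
    rintro c _ ε ε' x y rfl
    -- The residue `y` selects the component `r` and the path `(c + 1, δ)`; the type `ε'` selects
    -- which end of it, and hence the path `(c, ε')` joined to that end.
    obtain ⟨r, hr, δ, rfl⟩ := exists_natCast_add_eq hk y
    obtain ⟨t, ht, h⟩ := exists_pathEmpire_eq hk r c ε' ε x
    have hend : endIndex (4 * k) ε' < 4 * k := by cases ε' <;> simp [endIndex] <;> omega
    refine ⟨(⟨r, hr⟩, (c, ε'), ⟨t, ht⟩), (⟨r, hr⟩, (c + 1, δ), ⟨_, hend⟩),
      Or.inl ⟨rfl, ?_, Or.inl (Or.inr ⟨rfl, rfl⟩)⟩, h, pathEmpire_endIndex hk r _ δ ε'⟩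
    intro e
    have h1 : ∀ c : Fin 3, c ≠ c + 1 := by decide
    exact h1 c (congrArg (fun v => v.1.1) e)
  refine ⟨_, _, G, ⟨?_, ?_, ?_⟩, ?_⟩
  · intro α
    have h1 : {v | G.empire v = α}.ncard ≤ (Set.univ : Set (Fin k × Bool)).ncard := by
      -- An empire fixes the class `c` and occurs at most once on a path, so a vertex of it is known
      -- from its component and the Boolean of its path: `2k` choices.
      refine Set.ncard_le_ncard_of_injOn (fun v => (v.1, v.2.1.2)) (fun _ _ => Set.mem_univ _) ?_
      rintro ⟨r, ⟨c, e⟩, t⟩ hv ⟨r', ⟨c', e'⟩, t'⟩ hw hvw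
      obtain ⟨rfl, rfl⟩ := Prod.mk.inj hvw
      obtain ⟨rfl, h⟩ := pathEmpire_injOn t.2 t'.2 (hv.trans (Eq.symm hw))
      rw [Fin.ext h]
    rw [Set.ncard_univ, Nat.card_eq_fintype_card] at h1
    simp only [Fintype.card_prod, Fintype.card_fin, Fintype.card_bool] at h1
    omega
  · rw [Nat.card_eq_fintype_card]
    simp only [Fintype.card_prod, Fintype.card_fin, Fintype.card_bool, ZMod.card]
    ring
  · rintro ⟨⟨c, ε⟩, x⟩ ⟨⟨c', ε'⟩, y⟩ hne
    have h3 : ∀ c c' : Fin 3, c' = c ∨ c' = c + 1 ∨ c = c' + 1 := by decide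
    rcases h3 c c' with rfl | h | h
    · have hne' : (ε, x) ≠ (ε', y) := by
        rintro e
        obtain ⟨rfl, rfl⟩ := Prod.mk.inj e
        exact hne rfl
      obtain ⟨r, hr, e, t, ht, h⟩ := exists_pathEmpire_eq_succ hk c' hne'
      have hadj : G.graph.Adj (⟨r, hr⟩, (c', e), ⟨t, by omega⟩) (⟨r, hr⟩, (c', e), ⟨t + 1, ht⟩) :=
        Or.inl ⟨rfl, by simp, Or.inl (Or.inl ⟨rfl, rfl⟩)⟩
      rcases h with h | h
      · exact ⟨_, _, hadj, h.1, h.2⟩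
      · exact ⟨_, _, hadj.symm, h.2, h.1⟩
    · exact hspoke c c' ε ε' x y h
    · obtain ⟨v, w, h1, h2, h3⟩ := hspoke c' c ε' ε y x h
      exact ⟨w, v, h1.symm, h3, h2⟩
  · have ha : position (4 * k) a 0 = 12 := by
      rw [position_eq_corner hn a (e := false) rfl]; simp [corner, a, endX]
    have hb : position (4 * k) b 0 = 0 := by
      rw [position_eq_corner hn b (e := false) rfl]; simp [corner, b, endX]
    let φ : EuclideanSpace ℝ (Fin 2) →ₗ[ℝ] ℝ :=
      { toFun := fun z => z 0, map_add' := fun _ _ => rfl, map_smul' := fun _ _ => rfl }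
    -- Each copy has width `12`, so a horizontal shift by `13` leaves a gap for the link.
    refine ((isStraightDrawing_subdividedIcosahedron hn).chainGraph φ !₂[13, 0] (a := a) (b := b)
      (fun v => ?_) ?_ k).isPlanarGraph
    · change position (4 * k) b 0 ≤ position (4 * k) v 0 ∧
        position (4 * k) v 0 ≤ position (4 * k) a 0
      rw [ha, hb]
      exact position_coordinate_mem_Icc hn v
    · change position (4 * k) a 0 < position (4 * k) b 0 + (!₂[13, 0] : EuclideanSpace ℝ (Fin 2)) 0
      rw [ha, hb]
      norm_num
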